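/- For $p\in[0,1]$ let $\mathrm{BSC}_p$ be the binary symmetric channel with crossover probability $p$, which flips its input bit with probability $p$ and keeps it with probability $1-p$, and let $\mathrm{NAND}(a,b)=1-ab$ for $a,b\in\{0,1\}$. Let $A_p$ be the Markov transition kernel on $\{0,1\}^{\mathbb Z}$ of the elementary probabilistic cellular automaton with vertex noise $$\eta_{t+1}(n)=\mathrm{BSC}_p\big(\mathrm{NAND}(\eta_t(n-1),\eta_t(n))\big),\qquad n\in\mathbb Z,$$ where, given $\eta_t$, all sites are updated independently. Call a Markov transition kernel $F$ on $\{0,1\}^{\mathbb Z}$ ergodic if there is a probability measure $\mu$ on $\{0,1\}^{\mathbb Z}$ such that $\mu F=\mu$ and, for every probability measure $\nu$ on $\{0,1\}^{\mathbb Z}$, $\nu F^n$ converges weakly to $\mu$ as $n\to\infty$. **Theorem.** There exists $\epsilon\in(0,1/2]$ such that $A_p$ is ergodic for every $p\in(0,\epsilon)$. -/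

import Mathlib

open MeasureTheory ProbabilityTheory Filter Topology

/-- The configuration space `A^ℤ`, with the product topology and the product σ-algebra. -/
abbrev Configuration (A : Type*) : Type _ := ℤ → A

/-- The law of the next configuration of a one-dimensional PCA with local rule `f` depends
measurably on the current configuration. -/
theorem measurable_infinitePi_localRule {A : Type*} [MeasurableSpace A]
    (f : Kernel (A × A) A) [IsMarkovKernel f] :
    Measurable fun η : Configuration A =>
      Measure.infinitePi fun n : ℤ => f (η (n - 1), η n) := by
  refine Measurable.measure_of_isPiSystem_of_isProbabilityMeasure
    (generateFrom_squareCylinders (α := fun _ : ℤ => A)).symm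
    (isPiSystem_squareCylinders (fun _ => MeasurableSpace.isPiSystem_measurableSet)
      (fun _ => MeasurableSet.univ)) ?_
  rintro _ ⟨s, t, ht, rfl⟩
  have ht' : ∀ i, MeasurableSet (t i) := fun i => ht i (Set.mem_univ i)
  have hbox : ∀ η : Configuration A,
      Measure.infinitePi (fun n : ℤ => f (η (n - 1), η n)) ((s : Set ℤ).pi t) =
        ∏ i ∈ s, f (η (i - 1), η i) (t i) :=
    fun η => Measure.infinitePi_pi _ fun i _ => ht' i
  simp_rw [hbox]
  refine Finset.measurable_prod _ fun i _ => ?_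
  exact (f.measurable_coe (ht' i)).comp
    ((measurable_pi_apply (i - 1)).prodMk (measurable_pi_apply i))

/-- The transition kernel `F` of the one-dimensional PCA with alphabet `A` and random local rule
`η_{t+1}(n) = f(η_t(n-1), η_t(n))`: given `η_t`, the sites of `η_{t+1}` are independent and site `n`
has law `f (η_t(n-1), η_t(n))`. -/
noncomputable def pcaKernel {A : Type*} [MeasurableSpace A]
    (f : Kernel (A × A) A) [IsMarkovKernel f] :
    Kernel (Configuration A) (Configuration A) where
  toFun η := Measure.infinitePi fun n : ℤ => f (η (n - 1), η n)
  measurable' := measurable_infinitePi_localRule f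

instance instIsMarkovKernelPcaKernel {A : Type*} [MeasurableSpace A]
    (f : Kernel (A × A) A) [IsMarkovKernel f] : IsMarkovKernel (pcaKernel f) :=
  ⟨fun η => inferInstanceAs
    (IsProbabilityMeasure (Measure.infinitePi fun n : ℤ => f (η (n - 1), η n)))⟩

/-- One step `ν ↦ ν F` of the Markov chain with transition kernel `F`, acting on laws:
`(ν F)(B) = ∫ F(η, B) dν(η)`. -/
noncomputable def stepLaw {X : Type*} [MeasurableSpace X] (F : Kernel X X) [IsMarkovKernel F]
    (ν : ProbabilityMeasure X) : ProbabilityMeasure X :=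
  ⟨(ν : Measure X).bind F, inferInstance⟩

/-- `F` is ergodic: there is a probability measure `μ` with `μ F = μ` such that `ν F^n` converges
weakly to `μ` for every probability measure `ν`. (Convergence in `ProbabilityMeasure X` is weak
convergence.) -/
def IsErgodicKernel {X : Type*} [TopologicalSpace X] [MeasurableSpace X] [OpensMeasurableSpace X]
    (F : Kernel X X) [IsMarkovKernel F] : Prop :=
  ∃ μ : ProbabilityMeasure X, stepLaw F μ = μ ∧
    ∀ ν : ProbabilityMeasure X, Tendsto (fun n : ℕ => (stepLaw F)^[n] ν) atTop (𝓝 μ)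

/-- The binary symmetric channel with crossover probability `p`: the input bit `b` is flipped to
`!b` with probability `p` and kept with probability `1 - p`. -/
noncomputable def bsc (p : unitInterval) : Kernel Bool Bool where
  toFun b := bernoulliMeasure (!b) b p
  measurable' := measurable_of_countable _

instance instIsMarkovKernelBsc (p : unitInterval) : IsMarkovKernel (bsc p) :=
  ⟨fun b => inferInstanceAs (IsProbabilityMeasure (bernoulliMeasure (!b) b p))⟩

/-- The Boolean function NAND. -/
def nandBit (x : Bool × Bool) : Bool := !(x.1 && x.2)

/-- The random local rule `(a, b) ↦ BSC_p(NAND(a, b))`. -/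
noncomputable def noisyNand (p : unitInterval) : Kernel (Bool × Bool) Bool :=
  (bsc p).comap nandBit (measurable_of_countable _)

instance instIsMarkovKernelNoisyNand (p : unitInterval) : IsMarkovKernel (noisyNand p) :=
  inferInstanceAs (IsMarkovKernel ((bsc p).comap nandBit _))

/-- The transition kernel `A_p` of the elementary PCA with vertex noise
`η_{t+1}(n) = BSC_p(NAND(η_t(n-1), η_t(n)))`. -/
noncomputable def nandVertexNoisePCA (p : unitInterval) :
    Kernel (Configuration Bool) (Configuration Bool) :=
  pcaKernel (noisyNand p)

instance instIsMarkovKernelNandVertexNoisePCA (p : unitInterval) :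
    IsMarkovKernel (nandVertexNoisePCA p) :=
  inferInstanceAs (IsMarkovKernel (pcaKernel (noisyNand p)))

/-- NAND on `{0, 1, ?}`, where `none` stands for an undetermined bit. -/
def nandEnvelope : Option Bool → Option Bool → Option Bool
  | some false, _ => some true
  | _, some false => some true
  | some true, some true => some false
  | _, _ => none

/-- The weight of an undetermined site, as a function of its value and of the values of the two
sites that follow it. -/
def oneSidedWeight : Option Bool → Option Bool → Option Bool → ℤ
  | none, some false, _ => 0
  | none, none, _ => 1
  | none, some true, some true => 1
  | none, some true, _ => 2
  | some _, _, _ => 0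

/-- The reflection-symmetric local weight. -/
def localWeight (a b c : Option Bool) : ℤ := oneSidedWeight a b c + oneSidedWeight c b a

theorem localWeight_nonneg (a b c : Option Bool) : 0 ≤ localWeight a b c := by
  revert a b c; decide

/-- The local current of `localWeight` under the noiseless dynamics. -/
def localCurrent : Option Bool → Option Bool → Option Bool → ℤ
  | a, none, c => (if a = some true then 1 else 0) + (if c = some false then 1 else 0) - 1
  | a, some true, c =>
    -(if a = none then 1 else 0) - (if c = none ∧ a ≠ some true then 1 else 0)
  | _, some false, _ => 0

/-- The noiseless dynamics does not increase the weight, up to a discrete divergence. -/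
theorem localWeight_nandEnvelope_le (a b c d : Option Bool) :
    localWeight (nandEnvelope a b) (nandEnvelope b c) (nandEnvelope c d) ≤
      localWeight a b c + localCurrent a b c - localCurrent b c d := by
  revert a b c d; decide

/-- The triples of consecutive values that the noiseless dynamics can produce satisfy some
constraints around undetermined sites. -/
structure IsNandTriple (a b c : Option Bool) : Prop where
  right : a = none → b = some true → c = some true
  left : c = none → b = some true → a = some true
  middle : b = none → ¬(a = some false ∧ c = some false)

theorem isNandTriple_nandEnvelope (a b c d : Option Bool) :
    IsNandTriple (nandEnvelope a b) (nandEnvelope b c) (nandEnvelope c d) := by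
  constructor <;> revert a b c d <;> decide

/-- The expectation of a function of a noise variable which is `none` with probability `1 - 2p`,
and `some false` and `some true` with probability `p` each. -/
def noiseMean (p : ℝ) (f : Option Bool → ℝ) : ℝ :=
  (1 - 2 * p) * f none + p * f (some false) + p * f (some true)

/-- The expected local weight after the noise has acted on three consecutive sites. -/
def noisyWeight (p : ℝ) (a b c : Option Bool) : ℝ :=
  noiseMean p fun u => noiseMean p fun v => noiseMean p fun w =>
    (localWeight (u.or a) (v.or b) (w.or c) : ℝ)

/-- The local current of `localWeight` under the noise. -/
def noiseCurrent (p : ℝ) (a b : Option Bool) : ℝ :=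
  -(2 * p + (1 - 2 * p) * p ^ 2) * ((if a = none then 1 else 0) - (if b = none then 1 else 0)) +
    4 * p * (1 - p) * ((if a = none ∧ b = some false then 1 else 0) -
      (if a = some false ∧ b = none then 1 else 0))

/-- The noise strictly decreases the weight, up to a discrete divergence. -/
theorem noisyWeight_add_le {p : ℝ} (hp : 0 ≤ p) (hp' : p ≤ 1 / 2) {a b c : Option Bool}
    (h : IsNandTriple a b c) :
    noisyWeight p a b c + 4 * p ^ 2 * (if b = none then 1 else 0) ≤
      localWeight a b c + noiseCurrent p a b - noiseCurrent p b c := by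
  obtain ⟨h1, h2, h3⟩ := h
  have e1 : 0 ≤ p ^ 2 * (1 - 2 * p) := mul_nonneg (sq_nonneg p) (by linarith)
  have e2 : 0 ≤ p * (1 - p) := mul_nonneg hp (by linarith)
  have e3 : 0 ≤ p ^ 3 := by positivity
  have e4 : 0 ≤ p ^ 2 := by positivity
  have e5 : 0 ≤ p * (1 - 2 * p) := mul_nonneg hp (by linarith)
  have e6 : 0 ≤ p * (1 - 2 * p) ^ 2 := by positivity
  rcases a with _ | _ | _ <;> rcases b with _ | _ | _ <;> rcases c with _ | _ | _ <;>
    first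
    | (exfalso; revert h1 h2 h3; decide)
    | (clear h1 h2 h3
       simp [noisyWeight, noiseMean, localWeight, oneSidedWeight, noiseCurrent]
       try nlinarith [e1, e2, e3, e4, e5, e6])

/-- The discrete σ-algebra on `Option Bool`. -/
instance : MeasurableSpace (Option Bool) := ⊤

instance : DiscreteMeasurableSpace (Option Bool) := ⟨fun _ => trivial⟩

/-- The discrete topology on `Option Bool`. -/
instance : TopologicalSpace (Option Bool) := ⊥

instance : DiscreteTopology (Option Bool) := ⟨rfl⟩

/-- The law of a noise variable: `none` with probability `1 - 2p`, and `some false` and `some true`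
with probability `p` each. -/
noncomputable def noiseLaw (p : ℝ) : Measure (Option Bool) :=
  ENNReal.ofReal (1 - 2 * p) • Measure.dirac none +
    ENNReal.ofReal p • Measure.dirac (some false) + ENNReal.ofReal p • Measure.dirac (some true)

theorem isProbabilityMeasure_noiseLaw {p : ℝ} (hp : 0 ≤ p) (hp' : p ≤ 1 / 2) :
    IsProbabilityMeasure (noiseLaw p) := by
  constructor
  simp only [noiseLaw, Measure.add_apply, Measure.smul_apply, measure_univ, smul_eq_mul, mul_one]
  rw [← ENNReal.ofReal_add (by linarith) hp, ← ENNReal.ofReal_add (by linarith) hp]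
  ring_nf
  simp

theorem integral_noiseLaw {p : ℝ} (hp : 0 ≤ p) (hp' : p ≤ 1 / 2) (f : Option Bool → ℝ) :
    ∫ u, f u ∂noiseLaw p = noiseMean p f := by
  have hi : ∀ (c : ℝ) (a : Option Bool),
      Integrable f (ENNReal.ofReal c • Measure.dirac a) := fun c a =>
    (integrable_dirac (by simp)).smul_measure ENNReal.ofReal_ne_top
  rw [noiseLaw, integral_add_measure ((hi _ _).add_measure (hi _ _)) (hi _ _),
    integral_add_measure (hi _ _) (hi _ _)]
  simp [integral_smul_measure, noiseMean, ENNReal.toReal_ofReal hp,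
    ENNReal.toReal_ofReal (show 0 ≤ 1 - 2 * p by linarith)]

/-- Independent noise variables at all sites. -/
noncomputable def noiseField (p : ℝ) [IsProbabilityMeasure (noiseLaw p)] :
    Measure (Configuration (Option Bool)) :=
  Measure.infinitePi fun _ : ℤ => noiseLaw p

instance (p : ℝ) [IsProbabilityMeasure (noiseLaw p)] : IsProbabilityMeasure (noiseField p) :=
  inferInstanceAs (IsProbabilityMeasure (Measure.infinitePi fun _ : ℤ => noiseLaw p))

/-- The noise field is invariant under translations. -/
theorem noiseField_map_translate (p : ℝ) [IsProbabilityMeasure (noiseLaw p)] :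
    (noiseField p).map (fun w n => w (n + 1)) = noiseField p :=
  Measure.map_infinitePi_infinitePi_of_inj (P := fun _ : ℤ => noiseLaw p)
    (add_left_injective (1 : ℤ))

/-- The noise variables at three distinct sites are independent. -/
theorem noiseField_map_triple (p : ℝ) [IsProbabilityMeasure (noiseLaw p)] {i j k : ℤ}
    (hij : i ≠ j) (hik : i ≠ k) (hjk : j ≠ k) :
    (noiseField p).map (fun w => (w i, w j, w k)) =
      (noiseLaw p).prod ((noiseLaw p).prod (noiseLaw p)) := by
  refine Measure.ext_of_singleton fun ⟨a, b, c⟩ => ?_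
  rw [Measure.map_apply (by fun_prop) (measurableSet_singleton _)]
  have h : (fun w : Configuration (Option Bool) => (w i, w j, w k)) ⁻¹' {(a, b, c)} =
      (({i, j, k} : Finset ℤ) : Set ℤ).pi
        (fun n => if n = i then {a} else if n = j then {b} else {c}) := by
    ext w
    simp [hij.symm, hik.symm, hjk.symm]
  have hs : ({(a, b, c)} : Set (Option Bool × Option Bool × Option Bool)) = {a} ×ˢ {b} ×ˢ {c} := by
    simp
  rw [h, noiseField, Measure.infinitePi_pi _ (fun n _ => MeasurableSet.of_discrete), hs,
    Measure.prod_prod, Measure.prod_prod]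
  rw [Finset.prod_insert (by simp [hij, hik]), Finset.prod_insert (by simp [hjk])]
  simp [hij.symm, hik.symm, hjk.symm]

theorem integral_noiseField {p : ℝ} (hp : 0 ≤ p) (hp' : p ≤ 1 / 2)
    [IsProbabilityMeasure (noiseLaw p)] {i j k : ℤ}
    (hij : i ≠ j) (hik : i ≠ k) (hjk : j ≠ k)
    (f : Option Bool → Option Bool → Option Bool → ℝ) :
    ∫ w, f (w i) (w j) (w k) ∂noiseField p =
      noiseMean p fun u => noiseMean p fun v => noiseMean p fun w => f u v w := by
  have h := integral_map (μ := noiseField p) (φ := fun w => (w i, w j, w k)) (by fun_prop)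
    (f := fun t : Option Bool × Option Bool × Option Bool => f t.1 t.2.1 t.2.2)
    (measurable_of_countable _).aestronglyMeasurable
  rw [← h, noiseField_map_triple p hij hik hjk, integral_prod _ .of_finite]
  simp_rw [integral_prod _ (Integrable.of_finite), integral_noiseLaw hp hp']

/-- One step of the noisy NAND dynamics, driven by a noise configuration. -/
def nandStep (z : Configuration Bool × Configuration (Option Bool)) : Configuration Bool :=
  fun n => (z.2 n).getD (nandBit (z.1 (n - 1), z.1 n))

/-- One step of the envelope dynamics, driven by a noise configuration. -/
def envelopeStep (z : Configuration (Option Bool) × Configuration (Option Bool)) :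
    Configuration (Option Bool) :=
  fun n => (z.2 n).or (nandEnvelope (z.1 (n - 1)) (z.1 n))

theorem continuous_nandStep : Continuous nandStep := by
  refine continuous_pi fun n => ?_
  have : Continuous fun t : Option Bool × Bool × Bool => t.1.getD (nandBit (t.2.1, t.2.2)) :=
    continuous_of_discreteTopology
  exact this.comp (by fun_prop :
    Continuous fun z : Configuration Bool × Configuration (Option Bool) =>
      (z.2 n, z.1 (n - 1), z.1 n))

theorem measurable_nandStep : Measurable nandStep := by
  refine measurable_pi_lambda _ fun n => ?_
  exact (measurable_of_countable fun t : Option Bool × Bool × Bool =>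
    t.1.getD (nandBit (t.2.1, t.2.2))).comp (by fun_prop :
    Measurable fun z : Configuration Bool × Configuration (Option Bool) =>
      (z.2 n, z.1 (n - 1), z.1 n))

theorem measurable_envelopeStep : Measurable envelopeStep := by
  refine measurable_pi_lambda _ fun n => ?_
  exact (measurable_of_countable fun t : Option Bool × Option Bool × Option Bool =>
    t.1.or (nandEnvelope t.2.1 t.2.2)).comp (by fun_prop :
    Measurable fun z : Configuration (Option Bool) × Configuration (Option Bool) =>
      (z.2 n, z.1 (n - 1), z.1 n))

/-- A binary symmetric channel resamples its input by a fair bit with probability `2p`. -/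
theorem noiseLaw_map_getD (p : unitInterval) (hp' : (p : ℝ) ≤ 1 / 2) (b : Bool) :
    (noiseLaw p).map (fun u => u.getD b) = bsc p b := by
  have hp := p.2.1
  have hσ : ((unitInterval.toNNReal (unitInterval.symm p) : NNReal) : ENNReal) =
      ENNReal.ofReal (1 - 2 * p) + ENNReal.ofReal p := by
    rw [← ENNReal.ofReal_add (by linarith) hp, show 1 - 2 * (p : ℝ) + p = 1 - p by ring,
      ENNReal.ofReal]
    congr 1
    ext
    simp [Real.coe_toNNReal _ (sub_nonneg.2 p.2.2)]
  have hq : ((unitInterval.toNNReal p : NNReal) : ENNReal) = ENNReal.ofReal p := by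
    rw [ENNReal.ofReal]
    congr 1
    ext
    simp [Real.coe_toNNReal _ hp]
  have hb : bsc p b = (unitInterval.toNNReal p : ENNReal) • Measure.dirac (!b) +
      (unitInterval.toNNReal (unitInterval.symm p) : ENNReal) • Measure.dirac b := rfl
  rw [hb, hσ, hq, noiseLaw, Measure.map_add _ _ (measurable_of_countable _),
    Measure.map_add _ _ (measurable_of_countable _)]
  simp only [Measure.map_smul, Measure.map_dirac' (measurable_of_countable _)]
  cases b <;> simp [add_smul] <;> abel

/-- The law of one step of the dynamics started from a given configuration. -/
theorem nandVertexNoisePCA_apply (p : unitInterval) (hp' : (p : ℝ) ≤ 1 / 2)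
    [IsProbabilityMeasure (noiseLaw p)] (η : Configuration Bool) :
    nandVertexNoisePCA p η = (noiseField p).map fun w => nandStep (η, w) := by
  have h := Measure.infinitePi_map_pi (fun _ : ℤ => noiseLaw p)
    (f := fun n u => u.getD (nandBit (η (n - 1), η n))) (fun n => measurable_of_countable _)
  refine Eq.trans ?_ h.symm
  have hb : ∀ b, IsProbabilityMeasure ((noiseLaw p).map fun u => u.getD b) := fun b =>
    Measure.isProbabilityMeasure_map (measurable_of_countable _).aemeasurable
  change Measure.infinitePi (fun n : ℤ => bsc p (nandBit (η (n - 1), η n))) = _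
  congr 1
  funext n
  exact (noiseLaw_map_getD p hp' _).symm

/-- One step of the dynamics acting on laws. -/
theorem stepLaw_nandVertexNoisePCA (p : unitInterval) (hp' : (p : ℝ) ≤ 1 / 2)
    [IsProbabilityMeasure (noiseLaw p)] (ν : ProbabilityMeasure (Configuration Bool)) :
    (stepLaw (nandVertexNoisePCA p) ν : Measure (Configuration Bool)) =
      ((ν : Measure (Configuration Bool)).prod (noiseField p)).map nandStep := by
  ext s hs
  change ((ν : Measure (Configuration Bool)).bind (nandVertexNoisePCA p)) s = _
  rw [Measure.bind_apply hs (Kernel.aemeasurable _), Measure.map_apply measurable_nandStep hs,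
    Measure.prod_apply (measurable_nandStep hs)]
  refine lintegral_congr fun η => ?_
  rw [nandVertexNoisePCA_apply p hp']
  exact Measure.map_apply (measurable_nandStep.comp measurable_prodMk_left) hs

/-- The dynamics is Feller. -/
theorem continuous_stepLaw_nandVertexNoisePCA (p : unitInterval) (hp' : (p : ℝ) ≤ 1 / 2)
    [IsProbabilityMeasure (noiseLaw p)] : Continuous (stepLaw (nandVertexNoisePCA p)) := by
  have h : stepLaw (nandVertexNoisePCA p) = fun ν =>
      (ν.prod ⟨noiseField p, inferInstance⟩).map measurable_nandStep.aemeasurable := by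
    funext ν
    apply Subtype.ext
    exact stepLaw_nandVertexNoisePCA p hp' ν
  rw [h]
  exact (ProbabilityMeasure.continuous_map continuous_nandStep).comp
    (ProbabilityMeasure.continuous_prod.comp (continuous_id.prodMk continuous_const))

/-- The law at time `n` of the envelope dynamics started from the undetermined configuration. -/
noncomputable def envelopeLaw (p : ℝ) [IsProbabilityMeasure (noiseLaw p)] :
    ℕ → Measure (Configuration (Option Bool))
  | 0 => Measure.dirac fun _ => none
  | n + 1 => ((envelopeLaw p n).prod (noiseField p)).map envelopeStep

instance (p : ℝ) [IsProbabilityMeasure (noiseLaw p)] (n : ℕ) :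
    IsProbabilityMeasure (envelopeLaw p n) := by
  induction n with
  | zero => exact Measure.dirac.isProbabilityMeasure
  | succ n ih => exact Measure.isProbabilityMeasure_map measurable_envelopeStep.aemeasurable

theorem envelopeLaw_map_translate (p : ℝ) [IsProbabilityMeasure (noiseLaw p)] (n : ℕ) :
    (envelopeLaw p n).map (fun y i => y (i + 1)) = envelopeLaw p n := by
  have hm : Measurable fun (y : Configuration (Option Bool)) (i : ℤ) => y (i + 1) := by fun_prop
  induction n with
  | zero => rw [envelopeLaw, Measure.map_dirac' hm]
  | succ n ih =>
    have h : (fun (y : Configuration (Option Bool)) (i : ℤ) => y (i + 1)) ∘ envelopeStep =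
        envelopeStep ∘ Prod.map (fun y i => y (i + 1)) (fun y i => y (i + 1)) := by
      funext z i
      simp [envelopeStep]
    rw [envelopeLaw, Measure.map_map hm measurable_envelopeStep, h,
      ← Measure.map_map measurable_envelopeStep (hm.prodMap hm),
      ← Measure.map_prod_map _ _ hm hm, ih, noiseField_map_translate]

/-- A function of the values at finitely many sites is integrable. -/
theorem integrable_of_four_sites (μ : Measure (Configuration (Option Bool))) [IsFiniteMeasure μ]
    (f : Option Bool → Option Bool → Option Bool → Option Bool → ℝ) (i j k l : ℤ) :
    Integrable (fun y => f (y i) (y j) (y k) (y l)) μ := by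
  have hm : Measurable fun y : Configuration (Option Bool) => (y i, y j, y k, y l) := by fun_prop
  exact (Integrable.of_finite (μ := μ.map fun y => (y i, y j, y k, y l))
    (f := fun t : Option Bool × Option Bool × Option Bool × Option Bool =>
      f t.1 t.2.1 t.2.2.1 t.2.2.2)).comp_measurable hm

theorem integrable_of_three_sites (μ : Measure (Configuration (Option Bool))) [IsFiniteMeasure μ]
    (f : Option Bool → Option Bool → Option Bool → ℝ) (i j k : ℤ) :
    Integrable (fun y => f (y i) (y j) (y k)) μ :=
  integrable_of_four_sites μ (fun a b c _ => f a b c) i j k k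

theorem integral_envelopeLaw_translate (p : ℝ) [IsProbabilityMeasure (noiseLaw p)] (n : ℕ)
    (f : Option Bool → Option Bool → Option Bool → ℝ) (i j k : ℤ) :
    ∫ y, f (y (i + 1)) (y (j + 1)) (y (k + 1)) ∂envelopeLaw p n =
      ∫ y, f (y i) (y j) (y k) ∂envelopeLaw p n := by
  conv_rhs => rw [← envelopeLaw_map_translate p n]
  have ht : Measurable fun (y : Configuration (Option Bool)) (i : ℤ) => y (i + 1) := by fun_prop
  rw [integral_map ht.aemeasurable]
  have hm : Measurable fun y : Configuration (Option Bool) => (y i, y j, y k) := by fun_prop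
  exact ((measurable_of_countable fun t : Option Bool × Option Bool × Option Bool =>
    f t.1 t.2.1 t.2.2).comp hm).aestronglyMeasurable

/-- The expectation of a local function after one step of the envelope dynamics. -/
theorem integral_envelopeLaw_succ {p : ℝ} (hp : 0 ≤ p) (hp' : p ≤ 1 / 2)
    [IsProbabilityMeasure (noiseLaw p)] (n : ℕ)
    (f : Option Bool → Option Bool → Option Bool → ℝ) :
    ∫ y, f (y 1) (y 2) (y 3) ∂envelopeLaw p (n + 1) =
      ∫ y, noiseMean p (fun u => noiseMean p fun v => noiseMean p fun w =>
        f (u.or (nandEnvelope (y 0) (y 1))) (v.or (nandEnvelope (y 1) (y 2)))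
          (w.or (nandEnvelope (y 2) (y 3)))) ∂envelopeLaw p n := by
  have hi := integrable_of_three_sites (envelopeLaw p (n + 1)) f 1 2 3
  have hi' := hi
  rw [envelopeLaw, integrable_map_measure hi.aestronglyMeasurable
    measurable_envelopeStep.aemeasurable] at hi'
  rw [envelopeLaw, integral_map measurable_envelopeStep.aemeasurable hi.aestronglyMeasurable,
    integral_prod (fun z => f (envelopeStep z 1) (envelopeStep z 2) (envelopeStep z 3)) hi']
  refine integral_congr_ae (Eventually.of_forall fun y => ?_)
  exact integral_noiseField hp hp' (i := 1) (j := 2) (k := 3) (by norm_num) (by norm_num)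
    (by norm_num) fun u v w => f (u.or (nandEnvelope (y 0) (y 1)))
      (v.or (nandEnvelope (y 1) (y 2))) (w.or (nandEnvelope (y 2) (y 3)))

/-- The mean weight decreases by at least a multiple of the density of undetermined sites. -/
theorem integral_localWeight_succ_le {p : ℝ} (hp : 0 ≤ p) (hp' : p ≤ 1 / 2)
    [IsProbabilityMeasure (noiseLaw p)] (n : ℕ) :
    ∫ y, (localWeight (y 1) (y 2) (y 3) : ℝ) ∂envelopeLaw p (n + 1) +
        4 * p ^ 2 * ∫ y, (if y 2 = none then 1 else 0) ∂envelopeLaw p (n + 1) ≤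
      ∫ y, (localWeight (y 1) (y 2) (y 3) : ℝ) ∂envelopeLaw p n := by
  let H : Option Bool → Option Bool → Option Bool → ℝ := fun a b c =>
    localCurrent a b c + noiseCurrent p (nandEnvelope a b) (nandEnvelope b c)
  have hpt : ∀ y : Configuration (Option Bool),
      noisyWeight p (nandEnvelope (y 0) (y 1)) (nandEnvelope (y 1) (y 2))
          (nandEnvelope (y 2) (y 3)) +
        4 * p ^ 2 * (if nandEnvelope (y 1) (y 2) = none then 1 else 0) ≤
      localWeight (y 0) (y 1) (y 2) + H (y 0) (y 1) (y 2) - H (y 1) (y 2) (y 3) := fun y => by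
    have h1 := noisyWeight_add_le hp hp' (isNandTriple_nandEnvelope (y 0) (y 1) (y 2) (y 3))
    have h2 : ((localWeight (nandEnvelope (y 0) (y 1)) (nandEnvelope (y 1) (y 2))
        (nandEnvelope (y 2) (y 3)) : ℤ) : ℝ) ≤ _ :=
      Int.cast_le.2 (localWeight_nandEnvelope_le (y 0) (y 1) (y 2) (y 3))
    push_cast at h2
    simp only [H]
    linarith
  have hW := integral_envelopeLaw_translate p n (fun a b c => (localWeight a b c : ℝ)) 0 1 2
  have hH := integral_envelopeLaw_translate p n H 0 1 2
  norm_num at hW hH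
  have hsucc := integral_envelopeLaw_succ hp hp' n (fun a b c => (localWeight a b c : ℝ))
  have hnone := integral_envelopeLaw_succ hp hp' n (fun _ b _ => if b = none then 1 else 0)
  have hle : ∫ y, (if y 2 = none then (1 : ℝ) else 0) ∂envelopeLaw p (n + 1) ≤
      ∫ y, (if nandEnvelope (y 1) (y 2) = none then (1 : ℝ) else 0) ∂envelopeLaw p n := by
    rw [hnone]
    refine integral_mono
      (integrable_of_four_sites _ (fun a b c d => noiseMean p (fun _ => noiseMean p fun v =>
        noiseMean p fun _ => if v.or (nandEnvelope b c) = none then 1 else 0)) 0 1 2 3)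
      (integrable_of_three_sites _ (fun _ b c => if nandEnvelope b c = none then 1 else 0) 0 1 2)
      fun y => ?_
    simp only [noiseMean]
    split_ifs <;> simp_all
    nlinarith
  have hmono := integral_mono (μ := envelopeLaw p n)
    (integrable_of_four_sites _ (fun a b c d => noisyWeight p (nandEnvelope a b)
      (nandEnvelope b c) (nandEnvelope c d) +
        4 * p ^ 2 * (if nandEnvelope b c = none then 1 else 0)) 0 1 2 3)
    (integrable_of_four_sites _ (fun a b c d => localWeight a b c + H a b c - H b c d) 0 1 2 3)
    hpt
  have i1 := integrable_of_three_sites (envelopeLaw p n) (fun a b c => (localWeight a b c : ℝ)) 0 1 2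
  have i2 := integrable_of_three_sites (envelopeLaw p n) H 0 1 2
  have i3 := integrable_of_three_sites (envelopeLaw p n) H 1 2 3
  have i4 := integrable_of_four_sites (envelopeLaw p n) (fun a b c d => noisyWeight p
    (nandEnvelope a b) (nandEnvelope b c) (nandEnvelope c d)) 0 1 2 3
  have i5 := integrable_of_three_sites (envelopeLaw p n)
    (fun _ b c => 4 * p ^ 2 * if nandEnvelope b c = none then 1 else 0) 0 1 2
  have i12 : Integrable (fun y => localWeight (y 0) (y 1) (y 2) + H (y 0) (y 1) (y 2))
    (envelopeLaw p n) := i1.add i2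
  rw [integral_sub i12 i3, integral_add i1 i2, integral_add i4 i5, integral_const_mul,
    hH] at hmono
  have hp4 : 0 ≤ 4 * p ^ 2 := by positivity
  have := mul_le_mul_of_nonneg_left hle hp4
  have hsucc' : ∫ y, (localWeight (y 1) (y 2) (y 3) : ℝ) ∂envelopeLaw p (n + 1) =
      ∫ y, noisyWeight p (nandEnvelope (y 0) (y 1)) (nandEnvelope (y 1) (y 2))
        (nandEnvelope (y 2) (y 3)) ∂envelopeLaw p n := hsucc
  rw [hsucc', hW]
  linarith

/-- The density of undetermined sites does not depend on the site. -/
theorem envelopeLaw_none_eq (p : ℝ) [IsProbabilityMeasure (noiseLaw p)] (n : ℕ) (i : ℤ) :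
    (envelopeLaw p n).real {y | y i = none} = (envelopeLaw p n).real {y | y 0 = none} := by
  have h : ∀ i : ℤ, (envelopeLaw p n).real {y | y (i + 1) = none} =
      (envelopeLaw p n).real {y | y i = none} := fun i => by
    conv_rhs => rw [← envelopeLaw_map_translate p n]
    rw [map_measureReal_apply (by fun_prop)
      (measurableSet_eq_fun (measurable_pi_apply i) measurable_const)]
    rfl
  induction i using Int.induction_on with
  | zero => rfl
  | succ i ih => rw [h, ih]
  | pred i ih => rw [← ih, ← h, sub_add_cancel]

/-- Every site is eventually determined. -/
theorem tendsto_envelopeLaw_none {p : ℝ} (hp : 0 < p) (hp' : p ≤ 1 / 2)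
    [IsProbabilityMeasure (noiseLaw p)] :
    Tendsto (fun n => (envelopeLaw p n).real {y | y 0 = none}) atTop (𝓝 0) := by
  let W : ℕ → ℝ := fun n => ∫ y, (localWeight (y 1) (y 2) (y 3) : ℝ) ∂envelopeLaw p n
  let q : ℕ → ℝ := fun n => (envelopeLaw p n).real {y | y 0 = none}
  have hW : ∀ n, 0 ≤ W n := fun n =>
    integral_nonneg fun y => Int.cast_nonneg (localWeight_nonneg _ _ _)
  have hstep : ∀ n, W (n + 1) + 4 * p ^ 2 * q (n + 1) ≤ W n := fun n => by
    have h := integral_localWeight_succ_le hp.le hp' n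
    have h2 : ∫ y, (if y 2 = none then (1 : ℝ) else 0) ∂envelopeLaw p (n + 1) = q (n + 1) := by
      have hs : MeasurableSet {y : Configuration (Option Bool) | y 2 = none} :=
        measurableSet_eq_fun (measurable_pi_apply 2) measurable_const
      rw [show q (n + 1) = (envelopeLaw p (n + 1)).real {y | y 2 = none} from
        (envelopeLaw_none_eq p (n + 1) 2).symm, ← integral_indicator_one hs]
      simp [Set.indicator_apply]
    rw [h2] at h
    exact h
  have hsum : ∀ n, 4 * p ^ 2 * ∑ k ∈ Finset.range n, q (k + 1) ≤ W 0 - W n := fun n => by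
    induction n with
    | zero => simp
    | succ n ih =>
      rw [Finset.sum_range_succ, mul_add]
      linarith [hstep n]
  have hs : Summable fun k => q (k + 1) := by
    refine summable_of_sum_range_le (c := W 0 / (4 * p ^ 2)) (fun _ => measureReal_nonneg)
      fun n => ?_
    rw [le_div_iff₀ (by positivity), mul_comm]
    linarith [hsum n, hW n]
  exact (tendsto_add_atTop_iff_nat 1).1 hs.tendsto_atTop_zero

/-- The dynamics and its envelope can be coupled so that at any time, the configuration agrees
with the envelope wherever the latter is determined. -/
theorem exists_coupling_envelopeLaw (p : unitInterval) (hp' : (p : ℝ) ≤ 1 / 2)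
    [IsProbabilityMeasure (noiseLaw p)] (ν : ProbabilityMeasure (Configuration Bool)) (n : ℕ) :
    ∃ J : Measure (Configuration Bool × Configuration (Option Bool)), IsProbabilityMeasure J ∧
      J.map Prod.fst = ((stepLaw (nandVertexNoisePCA p))^[n] ν : Measure (Configuration Bool)) ∧
      J.map Prod.snd = envelopeLaw p n ∧
      ∀ᵐ z ∂J, ∀ i, z.2 i = none ∨ z.2 i = some (z.1 i) := by
  induction n with
  | zero =>
    refine ⟨(ν : Measure (Configuration Bool)).prod (Measure.dirac fun _ => none), inferInstance,
      by simp, by simp [envelopeLaw], ?_⟩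
    have h : ∀ᵐ y ∂Measure.dirac (fun _ : ℤ => (none : Option Bool)), ∀ i, y i = none := by
      refine ae_all_iff.2 fun i => (ae_dirac_iff ?_).2 rfl
      exact measurableSet_eq_fun (measurable_pi_apply i) measurable_const
    filter_upwards [Measure.quasiMeasurePreserving_snd.ae h] with z hz i
    exact Or.inl (hz i)
  | succ n ih =>
    obtain ⟨J, hJ, h1, h2, hc⟩ := ih
    let Ψ : (Configuration Bool × Configuration (Option Bool)) × Configuration (Option Bool) →
      Configuration Bool × Configuration (Option Bool) :=
      fun z => (nandStep (z.1.1, z.2), envelopeStep (z.1.2, z.2))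
    have m1 : Measurable fun z : (Configuration Bool × Configuration (Option Bool)) ×
        Configuration (Option Bool) => (z.1.1, z.2) := by fun_prop
    have m2 : Measurable fun z : (Configuration Bool × Configuration (Option Bool)) ×
        Configuration (Option Bool) => (z.1.2, z.2) := by fun_prop
    have hΨ : Measurable Ψ := (measurable_nandStep.comp m1).prodMk (measurable_envelopeStep.comp m2)
    refine ⟨(J.prod (noiseField p)).map Ψ, Measure.isProbabilityMeasure_map hΨ.aemeasurable,
      ?_, ?_, ?_⟩
    · rw [Function.iterate_succ_apply', stepLaw_nandVertexNoisePCA p hp', ← h1,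
        Measure.map_map measurable_fst hΨ]
      conv_rhs => rw [← Measure.map_id (μ := noiseField p),
        Measure.map_prod_map _ _ measurable_fst measurable_id,
        Measure.map_map measurable_nandStep (measurable_fst.prodMap measurable_id)]
      rfl
    · rw [envelopeLaw, ← h2, Measure.map_map measurable_snd hΨ]
      conv_rhs => rw [← Measure.map_id (μ := noiseField p),
        Measure.map_prod_map _ _ measurable_snd measurable_id,
        Measure.map_map measurable_envelopeStep (measurable_snd.prodMap measurable_id)]
      rfl
    · refine ae_all_iff.2 fun i => ?_
      have hm : MeasurableSet {z : Configuration Bool × Configuration (Option Bool) |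
          z.2 i = none ∨ z.2 i = some (z.1 i)} := by
        have : Measurable fun z : Configuration Bool × Configuration (Option Bool) =>
          (z.2 i, z.1 i) := by fun_prop
        exact this (MeasurableSet.of_discrete (s := {t : Option Bool × Bool |
          t.1 = none ∨ t.1 = some t.2}))
      refine (ae_map_iff hΨ.aemeasurable hm).2 ?_
      filter_upwards [Measure.quasiMeasurePreserving_fst.ae hc] with z hz
      have key : ∀ (w u v : Option Bool) (a b : Bool), (u = none ∨ u = some a) →
          (v = none ∨ v = some b) →
          (w.or (nandEnvelope u v) = none ∨
            w.or (nandEnvelope u v) = some (w.getD (nandBit (a, b)))) := by decide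
      exact key _ _ _ _ _ (hz (i - 1)) (hz i)

/-- At a given time, the probabilities of a cylinder for two initial laws differ at most by the
probability that the envelope is undetermined somewhere on the support of the cylinder. -/
theorem abs_iterate_stepLaw_sub_le (p : unitInterval) (hp' : (p : ℝ) ≤ 1 / 2)
    [IsProbabilityMeasure (noiseLaw p)] (ν ν' : ProbabilityMeasure (Configuration Bool)) (n : ℕ)
    (s : Finset ℤ) (t : ℤ → Set Bool) :
    |((stepLaw (nandVertexNoisePCA p))^[n] ν : Measure (Configuration Bool)).real ((s : Set ℤ).pi t) -
      ((stepLaw (nandVertexNoisePCA p))^[n] ν' : Measure (Configuration Bool)).real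
        ((s : Set ℤ).pi t)| ≤ s.card * (envelopeLaw p n).real {y | y 0 = none} := by
  have hB : MeasurableSet ((s : Set ℤ).pi t) :=
    MeasurableSet.pi s.countable_toSet fun _ _ => MeasurableSet.of_discrete
  have hN : ∀ i : ℤ, MeasurableSet {y : Configuration (Option Bool) | y i = none} := fun i =>
    measurableSet_eq_fun (measurable_pi_apply i) measurable_const
  let C : Set (Configuration (Option Bool)) := (s : Set ℤ).pi fun i => some '' t i
  have hC : MeasurableSet C :=
    MeasurableSet.pi s.countable_toSet fun _ _ => MeasurableSet.of_discrete
  let U : Set (Configuration (Option Bool)) := ⋃ i ∈ s, {y | y i = none}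
  have hU : MeasurableSet U := Finset.measurableSet_biUnion s fun i _ => hN i
  have hUle : (envelopeLaw p n).real U ≤ s.card * (envelopeLaw p n).real {y | y 0 = none} := by
    refine (measureReal_biUnion_finset_le s _).trans ?_
    simp [envelopeLaw_none_eq p n]
  have key : ∀ ν : ProbabilityMeasure (Configuration Bool),
      (envelopeLaw p n).real C ≤
        ((stepLaw (nandVertexNoisePCA p))^[n] ν : Measure (Configuration Bool)).real
          ((s : Set ℤ).pi t) ∧
      ((stepLaw (nandVertexNoisePCA p))^[n] ν : Measure (Configuration Bool)).real
          ((s : Set ℤ).pi t) ≤ (envelopeLaw p n).real C + (envelopeLaw p n).real U := fun ν => by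
    obtain ⟨J, hJ, h1, h2, hc⟩ := exists_coupling_envelopeLaw p hp' ν n
    rw [← h1, ← h2, map_measureReal_apply measurable_snd hC,
      map_measureReal_apply measurable_snd hU, map_measureReal_apply measurable_fst hB]
    constructor
    · refine ENNReal.toReal_mono (measure_ne_top _ _) (measure_mono_ae ?_)
      filter_upwards [hc] with z hz hzC i hi
      obtain ⟨b, hb, hbz⟩ := hzC i hi
      rcases hz i with h | h
      · simp [h] at hbz
      · rw [← hbz] at h
        rwa [← Option.some.inj h]
    · refine le_trans (ENNReal.toReal_mono (measure_ne_top _ _) (measure_mono_ae ?_)) (measureReal_union_le _ _)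
      filter_upwards [hc] with z hz hzB
      by_cases hzU : z.2 ∈ U
      · exact Or.inr hzU
      · refine Or.inl fun i hi => ?_
        have hne : z.2 i ≠ none := fun h => hzU (Set.mem_biUnion hi h)
        exact ⟨z.1 i, hzB i hi, ((hz i).resolve_left hne).symm⟩
  have a := key ν
  have b := key ν'
  rw [abs_le]
  constructor <;> linarith

/-- A sufficient condition for ergodicity: the transition kernel is Feller and asymptotically
forgets the initial law along a convergence-determining class of sets. -/
theorem isErgodicKernel_of_forgetting {X : Type*} [TopologicalSpace X] [T2Space X] [CompactSpace X]
    [SecondCountableTopology X] [MeasurableSpace X] [BorelSpace X] [Nonempty X]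
    {F : Kernel X X} [IsMarkovKernel F] (hF : Continuous (stepLaw F)) {S : Set (Set X)}
    (hS : IsPiSystem S) (hclopen : ∀ s ∈ S, IsClopen s)
    (hbasis : ∀ u : Set X, IsOpen u → ∀ x ∈ u, ∃ s ∈ S, s ∈ 𝓝 x ∧ s ⊆ u)
    (hforget : ∀ s ∈ S, ∃ δ : ℕ → ℝ, Tendsto δ atTop (𝓝 0) ∧
      ∀ ν ν' : ProbabilityMeasure X, ∀ n,
        |((stepLaw F)^[n] ν : Measure X).real s - ((stepLaw F)^[n] ν' : Measure X).real s| ≤ δ n) :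
    IsErgodicKernel F := by
  let ν₀ : ProbabilityMeasure X := ⟨Measure.dirac (Classical.arbitrary X), inferInstance⟩
  obtain ⟨μ, hμ⟩ := exists_clusterPt_of_compactSpace (map (fun n => (stepLaw F)^[n] ν₀) atTop)
  have hμ' : MapClusterPt μ atTop (fun n => (stepLaw F)^[n] ν₀) := hμ
  have hlim : ∀ ν : ProbabilityMeasure X,
      Tendsto (fun n => (stepLaw F)^[n] ν) atTop (𝓝 μ) := fun ν => by
    refine hS.tendsto_probabilityMeasure_of_tendsto_of_mem
      (fun s hs => (hclopen s hs).isOpen.measurableSet) hbasis fun s hs => ?_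
    obtain ⟨δ, hδ, hle⟩ := hforget s hs
    let a : ℕ → ℝ := fun n => ((stepLaw F)^[n] ν₀ : Measure X).real s
    have ha : CauchySeq a := by
      refine cauchySeq_of_le_tendsto_0' δ (fun n m hnm => ?_) hδ
      obtain ⟨k, rfl⟩ := Nat.exists_eq_add_of_le hnm
      rw [Real.dist_eq]
      have := hle ν₀ ((stepLaw F)^[k] ν₀) n
      rwa [← Function.iterate_add_apply] at this
    obtain ⟨c, hc⟩ := cauchySeq_tendsto_of_complete ha
    have hcont : ContinuousAt (fun ρ : ProbabilityMeasure X => (ρ : Measure X).real s) μ := by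
      have h := ProbabilityMeasure.tendsto_measure_of_null_frontier_of_tendsto
        (μ := μ) (μs := fun ρ => ρ) tendsto_id (E := s) (by simp [(hclopen s hs).frontier_eq])
      exact (NNReal.continuous_coe.tendsto _).comp h
    have hac : MapClusterPt ((μ : Measure X).real s) atTop a := hμ'.continuousAt_comp hcont
    have hcμ : c = (μ : Measure X).real s := by
      have : (𝓝 ((μ : Measure X).real s) ⊓ 𝓝 c).NeBot := ClusterPt.mono hac hc
      exact (eq_of_nhds_neBot this).symm
    rw [← NNReal.tendsto_coe]
    change Tendsto (fun n => ((stepLaw F)^[n] ν : Measure X).real s) atTop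
      (𝓝 ((μ : Measure X).real s))
    rw [← hcμ]
    have hd : Tendsto (fun n => ((stepLaw F)^[n] ν : Measure X).real s - a n) atTop (𝓝 0) :=
      squeeze_zero_norm (fun n => hle ν ν₀ n) hδ
    simpa using hd.add hc
  refine ⟨μ, ?_, hlim⟩
  refine tendsto_nhds_unique ((hF.tendsto μ).comp (hlim ν₀)) ?_
  refine (hlim (stepLaw F ν₀)).congr fun n => ?_
  rw [← Function.iterate_succ_apply, Function.iterate_succ_apply']
  rfl

theorem mainTheorem4 :
    ∃ ε : ℝ, 0 < ε ∧ ε ≤ 1 / 2 ∧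
      ∀ p : unitInterval, (p : ℝ) ∈ Set.Ioo 0 ε → IsErgodicKernel (nandVertexNoisePCA p) := by
  refine ⟨1 / 2, by norm_num, le_rfl, fun p hp => ?_⟩
  have hp' : (p : ℝ) ≤ 1 / 2 := hp.2.le
  have := isProbabilityMeasure_noiseLaw hp.1.le hp'
  refine isErgodicKernel_of_forgetting (continuous_stepLaw_nandVertexNoisePCA p hp')
    (S := squareCylinders fun _ : ℤ => {s : Set Bool | MeasurableSet s})
    (isPiSystem_squareCylinders (fun _ => MeasurableSpace.isPiSystem_measurableSet)
      (by simp)) ?_ ?_ ?_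
  · rintro _ ⟨s, t, -, rfl⟩
    exact ⟨isClosed_set_pi fun _ _ => isClosed_discrete _,
      isOpen_set_pi s.finite_toSet fun _ _ => isOpen_discrete _⟩
  · intro u hu x hx
    obtain ⟨s, t, ht, hsub⟩ := isOpen_pi_iff.1 hu x hx
    exact ⟨(s : Set ℤ).pi t, ⟨s, t, by simp, rfl⟩,
      set_pi_mem_nhds s.finite_toSet fun i hi => (ht i hi).1.mem_nhds (ht i hi).2, hsub⟩
  · rintro _ ⟨s, t, -, rfl⟩
    refine ⟨fun n => s.card * (envelopeLaw p n).real {y | y 0 = none}, ?_,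
      fun ν ν' n => abs_iterate_stepLaw_sub_le p hp' ν ν' n s t⟩
    simpa using (tendsto_envelopeLaw_none hp.1 hp').const_mul (s.card : ℝ)
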